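/- Let $a,b,c$ be the automorphisms of the rooted ternary tree (whose level $n$ consists of the words of length $n$ over $\{0,1,2\}$) given by the self-similar rules $a=(01)(\mathrm{id},\mathrm{id},a)$, $b=(02)(\mathrm{id},b,\mathrm{id})$, $c=(12)(c,\mathrm{id},\mathrm{id})$; that is, for every word $w$, $a(0w)=1w$, $a(1w)=0w$, $a(2w)=2a(w)$; $b(0w)=2w$, $b(2w)=0w$, $b(1w)=1b(w)$; $c(1w)=2w$, $c(2w)=1w$, $c(0w)=0c(w)$ (and each generator fixes the empty word). They generate the Hanoi Towers group $H^{(3)}$. For $n\ge 1$ let $\Sigma_n$ be its $n$-th Schreier graph with loops removed: the vertices are the $3^n$ words of length $n$ over $\{0,1,2\}$, and distinct words $u,v$ are adjacent if and only if $s(u)=v$ for some $s\in\{a,b,c\}$. The outmost vertices of $\Sigma_n$ are $0^n,1^n,2^n$. A spanning $k$-forest of $\Sigma_n$ is an acyclic subgraph containing all vertices and having exactly $k$ connected components. Let - $\tau_n=\tau(\Sigma_n)$ be the complexity of $\Sigma_n$, i.e. its number of spanning trees; - $s_n$ be the number of spanning $2$-forests of $\Sigma_n$ in which two fixed outmost vertices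 lie in the same component and the third outmost vertex lies in the other component; - $q_n$ be the number of spanning $3$-forests of $\Sigma_n$ in which each component contains exactly one outmost vertex. Then for every $n\ge 1$, $$\tau_n = 3^{\frac{3^n+2n-1}{4}}\cdot 5^{\frac{3^n-2n-1}{4}},$$ $$s_n = 3^{\frac{3^n-2n-1}{4}}\cdot 5^{\frac{3^n-2n-1}{4}}\cdot\frac{5^n-3^n}{2}$$ (for each choice of the two fixed outmost vertices), and $$q_n = 3^{\frac{3^n-6n+3}{4}}\cdot 5^{\frac{3^n-2n-1}{4}}\cdot\left(\frac{5^n-3^n}{2}\right)^2.$$ In particular, the asymptotic growth constant of the spanning trees of $\Sigma_n$ is $$\lim_{n\to\infty}\frac{\log \tau_n}{|V(\Sigma_n)|}=\frac14\left(\log 3+\log 5\right).$$ -/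

import Mathlib

/-- Words of length `n` over the alphabet `{0, 1, 2}`, i.e. the vertices of the `n`-th level of the
rooted ternary tree. The letter `w 0` is the first one (next to the root). -/
abbrev HanoiWord (n : ℕ) : Type := Fin n → Fin 3

/-- The map `g` on words of length `n` determined by the self-similar rule
`g (y w) = σ(y) g(w)` if `y = x` and `g (y w) = σ(y) w` if `y ≠ x`. -/
def hanoiMap (σ : Equiv.Perm (Fin 3)) (x : Fin 3) : (n : ℕ) → HanoiWord n → HanoiWord n
  | 0, w => w
  | n + 1, w =>
      Fin.cons (σ (w 0)) (if w 0 = x then hanoiMap σ x n (Fin.tail w) else Fin.tail w)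

theorem hanoiMap_inverse (σ : Equiv.Perm (Fin 3)) (x : Fin 3) (n : ℕ) (w : HanoiWord n) :
    hanoiMap σ⁻¹ (σ x) n (hanoiMap σ x n w) = w := by
  induction n with
  | zero => rfl
  | succ n ih =>
    by_cases h : w 0 = x
    · subst h
      simp [hanoiMap, ih]
    · simp [hanoiMap, h]

/-- The action on the `n`-th level of the tree automorphism `g` with self-similar form
`g = σ(g₀, g₁, g₂)`, where `g_x = g` and the other two restrictions are the identity. -/
def hanoiPerm (σ : Equiv.Perm (Fin 3)) (x : Fin 3) (n : ℕ) : Equiv.Perm (HanoiWord n) where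
  toFun := hanoiMap σ x n
  invFun := hanoiMap σ⁻¹ (σ x) n
  left_inv := hanoiMap_inverse σ x n
  right_inv w := by simpa using hanoiMap_inverse σ⁻¹ (σ x) n w

/-- The generator `a = (01)(id, id, a)` of the Hanoi Towers group, acting on level `n`. -/
def hanoiA (n : ℕ) : Equiv.Perm (HanoiWord n) := hanoiPerm (Equiv.swap 0 1) 2 n

/-- The generator `b = (02)(id, b, id)` of the Hanoi Towers group, acting on level `n`. -/
def hanoiB (n : ℕ) : Equiv.Perm (HanoiWord n) := hanoiPerm (Equiv.swap 0 2) 1 n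

/-- The generator `c = (12)(c, id, id)` of the Hanoi Towers group, acting on level `n`. -/
def hanoiC (n : ℕ) : Equiv.Perm (HanoiWord n) := hanoiPerm (Equiv.swap 1 2) 0 n

/-- The Schreier graph, without its loops, of the action of the group generated by a set `S` of
permutations of `V`: distinct `u` and `v` are adjacent iff some `s ∈ S` maps one to the other. -/
def schreierGraph {V : Type*} (S : Set (Equiv.Perm V)) : SimpleGraph V :=
  SimpleGraph.fromRel fun u v => ∃ s ∈ S, s u = v

/-- The `n`-th Schreier graph `Σ_n` of the Hanoi Towers group, with its loops removed. Different
generators never join the same two distinct vertices, so a simple graph loses no edges. -/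
def hanoiGraph (n : ℕ) : SimpleGraph (HanoiWord n) :=
  schreierGraph {hanoiA n, hanoiB n, hanoiC n}

/-- The three outmost vertices `0ⁿ`, `1ⁿ`, `2ⁿ` of `Σ_n`. -/
def hanoiCorner (n : ℕ) (i : Fin 3) : HanoiWord n := fun _ => i

/-- The spanning trees of `G`, as graphs on the vertex set of `G`. -/
def spanningTrees {V : Type*} (G : SimpleGraph V) : Set (SimpleGraph V) :=
  {T | T ≤ G ∧ T.IsTree}

/-- The spanning `k`-forests of `G`: spanning acyclic subgraphs with exactly `k` connected
components (an isolated vertex counts as a component). -/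
def spanningForests {V : Type*} (G : SimpleGraph V) (k : ℕ) : Set (SimpleGraph V) :=
  {F | F ≤ G ∧ F.IsAcyclic ∧ Nat.card F.ConnectedComponent = k}

/-- `τ_n`: the complexity (number of spanning trees) of `Σ_n`. -/
noncomputable def hanoiTau (n : ℕ) : ℕ := (spanningTrees (hanoiGraph n)).ncard

/-- `s_n`: the number of spanning `2`-forests of `Σ_n` in which the outmost vertex `iⁿ` lies in one
component and the other two outmost vertices lie together in the other one. -/
noncomputable def hanoiS (n : ℕ) (i : Fin 3) : ℕ :=
  {F | F ∈ spanningForests (hanoiGraph n) 2 ∧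
    (∀ j k, j ≠ i → k ≠ i → F.Reachable (hanoiCorner n j) (hanoiCorner n k)) ∧
    (∀ j, j ≠ i → ¬ F.Reachable (hanoiCorner n i) (hanoiCorner n j))}.ncard

/-- `q_n`: the number of spanning `3`-forests of `Σ_n` in which each component contains exactly one
outmost vertex. -/
noncomputable def hanoiQ (n : ℕ) : ℕ :=
  {F | F ∈ spanningForests (hanoiGraph n) 3 ∧
    ∀ C : F.ConnectedComponent, ∃! i : Fin 3, hanoiCorner n i ∈ C.supp}.ncard

/-! Classify the spanning forests of Σ_n in which every component meets a corner by the partition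
they induce on the three corners: one block is counted by τ, one separated corner by s, three blocks
by q. Splitting words by their last letter, Σ_{n+1} is a ring of three copies of Σ_n: for each k an
edge joins the corners k^n of the two copies other than copy k, and the new corners are corner i of
copy i (`hanoiGraph_comap`). A forest of the ring is a set of connecting edges together with such a
forest in each copy, and the type of the result depends only on these edges and the three partitions
(`cornerForestsGlueEquiv`). Hence τ, s, q satisfy homogeneous cubic recursions.

The recursions preserve the shape s = τr, q = 3τr². Under it the three cubics become 3τ³(1+2r),
τ³(1+2r)(1+5r) and τ³(1+2r)(1+5r)², so the shape persists with τ replaced by 3τ³(1+2r) and r by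
(5r+1)/3 (`sum_isGluing_eq`). Level 0 is a single vertex, with τ = 1 and r = 0, so 1+2r = (5/3)^n at
level n (`hanoiCount_eq`), and the closed forms follow. -/

/-- The partitions of the three corners: `none` has a single block, `some none` has three, and
`some (some k)` separates the corner `k` from the other two. -/
abbrev CornerPartition : Type := Option (Option (Fin 3))

namespace CornerPartition

/-- A label for the block of the partition `π` that contains the corner `i`. -/
def label : CornerPartition → Fin 3 → ℕ
  | none, _ => 0
  | some none, i => i
  | some (some k), i => if i = k then 1 else 0

theorem label_lt (π : CornerPartition) (i : Fin 3) : π.label i < 3 := by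
  revert π i; decide

theorem label_injective {π ρ : CornerPartition}
    (h : ∀ i j, π.label i = π.label j ↔ ρ.label i = ρ.label j) : π = ρ := by
  revert π ρ; decide

/-- Of the eight truth patterns for the three pairs of corners, transitivity excludes those with
exactly two related pairs; the other five are the five partitions. -/
theorem exists_label {r : Fin 3 → Fin 3 → Prop} (hr : Equivalence r) :
    ∃ π : CornerPartition, ∀ i j, r i j ↔ π.label i = π.label j := by
  have refl := hr.refl
  have comm : ∀ i j, r i j ↔ r j i := fun i j => ⟨hr.symm, hr.symm⟩
  have h012 : r 0 1 → r 1 2 → r 0 2 := hr.trans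
  have h021 : r 0 2 → r 1 2 → r 0 1 := fun h h' => hr.trans h (hr.symm h')
  have h102 : r 0 1 → r 0 2 → r 1 2 := fun h h' => hr.trans (hr.symm h) h'
  have h10 := comm 1 0
  have h20 := comm 2 0
  have h21 := comm 2 1
  by_cases a : r 0 1 <;> by_cases b : r 0 2 <;> by_cases c : r 1 2 <;>
    first
      | exact absurd (h012 a c) b
      | exact absurd (h021 b c) a
      | exact absurd (h102 a b) c
      | (refine ⟨none, ?_⟩; simp [Fin.forall_fin_succ, label, *]; done)
      | (refine ⟨some none, ?_⟩; simp [Fin.forall_fin_succ, label, *]; done)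
      | (refine ⟨some (some 0), ?_⟩; simp [Fin.forall_fin_succ, label, *]; done)
      | (refine ⟨some (some 1), ?_⟩; simp [Fin.forall_fin_succ, label, *]; done)
      | (refine ⟨some (some 2), ?_⟩; simp [Fin.forall_fin_succ, label, *])

end CornerPartition

/-! ### Forests whose components all meet a corner -/

namespace SimpleGraph

/-- `F` is a forest, each component of which contains a corner `t i`, and `F` induces the
partition `π` on the corners. -/
structure IsCornerForest {V : Type*} (F : SimpleGraph V) (t : Fin 3 → V) (π : CornerPartition) :
    Prop where
  isAcyclic : F.IsAcyclic
  exists_reachable : ∀ v, ∃ i, F.Reachable v (t i)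
  reachable_iff : ∀ i j, F.Reachable (t i) (t j) ↔ π.label i = π.label j

theorem IsCornerForest.eq {V : Type*} {F : SimpleGraph V} {t : Fin 3 → V} {π ρ : CornerPartition}
    (h : F.IsCornerForest t π) (h' : F.IsCornerForest t ρ) : π = ρ :=
  CornerPartition.label_injective fun i j => (h.reachable_iff i j).symm.trans (h'.reachable_iff i j)

/-- The spanning forests of `G`, each component of which contains a corner, that induce the
partition `π` on the corners. -/
def cornerForests {V : Type*} (G : SimpleGraph V) (t : Fin 3 → V) (π : CornerPartition) :
    Set (SimpleGraph V) :=
  {F | F ≤ G ∧ F.IsCornerForest t π}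

/-- A walk can be shortened so that it crosses the new edge at most once, in one of two directions.
-/
theorem reachable_sup_edge_iff {W : Type*} {G : SimpleGraph W} {u v x y : W} :
    (G ⊔ edge u v).Reachable x y ↔ G.Reachable x y ∨ (G.Reachable x u ∧ G.Reachable v y) ∨
      (G.Reachable x v ∧ G.Reachable u y) := by
  constructor
  · rintro ⟨p⟩
    induction p with
    | nil => exact Or.inl .rfl
    | cons h p ih =>
      rw [sup_adj, edge_adj] at h
      rcases h with h | ⟨⟨rfl, rfl⟩ | ⟨rfl, rfl⟩, -⟩
      · rcases ih with ih | ⟨ih, ih'⟩ | ⟨ih, ih'⟩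
        · exact Or.inl (h.reachable.trans ih)
        · exact Or.inr (Or.inl ⟨h.reachable.trans ih, ih'⟩)
        · exact Or.inr (Or.inr ⟨h.reachable.trans ih, ih'⟩)
      · rcases ih with ih | ⟨ih, ih'⟩ | ⟨ih, ih'⟩
        · exact Or.inr (Or.inl ⟨.rfl, ih⟩)
        · exact Or.inr (Or.inl ⟨.rfl, ih'⟩)
        · exact Or.inl ih'
      · rcases ih with ih | ⟨ih, ih'⟩ | ⟨ih, ih'⟩
        · exact Or.inr (Or.inr ⟨.rfl, ih⟩)
        · exact Or.inl ih'
        · exact Or.inr (Or.inr ⟨.rfl, ih'⟩)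
  · have hle : G ≤ G ⊔ edge u v := le_sup_left
    have huv : (G ⊔ edge u v).Reachable u v := by
      by_cases h : u = v
      · exact h ▸ .rfl
      · exact Adj.reachable (by simp [edge_adj, h])
    rintro (h | ⟨h, h'⟩ | ⟨h, h'⟩)
    · exact h.mono hle
    · exact (h.mono hle).trans (huv.trans (h'.mono hle))
    · exact (h.mono hle).trans (huv.symm.trans (h'.mono hle))

/-! ### Gluing three copies in a ring -/

/-- Three graphs on copies of `V`, where the edge that joins the corners `t k` of the two copies
other than `k` is added if `K k`. -/
def glue {V : Type*} (t : Fin 3 → V) (F : Fin 3 → SimpleGraph V) (K : Fin 3 → Bool) :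
    SimpleGraph (Fin 3 × V) where
  Adj x y := (x.1 = y.1 ∧ (F x.1).Adj x.2 y.2) ∨
    -- For distinct i and j in `Fin 3`, the element -(i + j) is the third index, since 0 + 1 + 2 = 0
    -- there.
    (x.1 ≠ y.1 ∧ K (-(x.1 + y.1)) ∧ x.2 = t (-(x.1 + y.1)) ∧ y.2 = t (-(x.1 + y.1)))
  symm := by
    constructor
    rintro ⟨i, u⟩ ⟨j, v⟩ (⟨rfl, h⟩ | ⟨h, h'⟩)
    · exact Or.inl ⟨rfl, h.symm⟩
    · refine Or.inr ⟨Ne.symm h, ?_⟩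
      rw [add_comm]
      tauto
  loopless := by
    constructor
    rintro ⟨i, u⟩ h
    simp at h

variable {V : Type*} {t : Fin 3 → V} {F F' : Fin 3 → SimpleGraph V} {K K' : Fin 3 → Bool}

theorem glue_adj {x y : Fin 3 × V} : (glue t F K).Adj x y ↔ (x.1 = y.1 ∧ (F x.1).Adj x.2 y.2) ∨
    (x.1 ≠ y.1 ∧ K (-(x.1 + y.1)) ∧ x.2 = t (-(x.1 + y.1)) ∧ y.2 = t (-(x.1 + y.1))) :=
  Iff.rfl

theorem glue_adj_same {i : Fin 3} {u v : V} : (glue t F K).Adj (i, u) (i, v) ↔ (F i).Adj u v := by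
  simp [glue_adj]

theorem glue_adj_edge (k : Fin 3) :
    (glue t F K).Adj (k + 1, t k) (k + 2, t k) ↔ K k = true := by
  have h : -(k + 1 + (k + 2)) = k := by revert k; decide
  have h' : k + 1 ≠ k + 2 := by revert k; decide
  simp only [glue_adj, h]
  simp [h']

theorem exists_eq_of_ne {i j : Fin 3} (h : i ≠ j) :
    ∃ k, -(i + j) = k ∧ ((i = k + 1 ∧ j = k + 2) ∨ (i = k + 2 ∧ j = k + 1)) := by
  revert i j; decide

theorem glue_le_glue_iff : glue t F K ≤ glue t F' K' ↔ F ≤ F' ∧ K ≤ K' := by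
  constructor
  · refine fun h => ⟨fun i u v huv => ?_, fun k => ?_⟩
    · exact glue_adj_same.1 (h (glue_adj_same.2 huv))
    · intro hk
      exact (glue_adj_edge k).1 (h ((glue_adj_edge k).2 hk))
  · rintro ⟨hF, hK⟩ ⟨i, u⟩ ⟨j, v⟩ (⟨rfl, h⟩ | ⟨hij, hk, h⟩)
    · exact Or.inl ⟨rfl, hF _ h⟩
    · exact Or.inr ⟨hij, hK _ hk, h⟩

theorem glue_injective (h : glue t F K = glue t F' K') : F = F' ∧ K = K' := by
  obtain ⟨h₁, h₂⟩ := glue_le_glue_iff.1 h.le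
  obtain ⟨h₃, h₄⟩ := glue_le_glue_iff.1 h.ge
  exact ⟨le_antisymm h₁ h₃, le_antisymm h₂ h₄⟩

open Classical in
theorem exists_glue_eq_of_le {H : SimpleGraph (Fin 3 × V)} (h : H ≤ glue t F K) :
    ∃ F' K', glue t F' K' = H := by
  refine ⟨fun i => H.comap (fun v => (i, v)), fun k => decide (H.Adj (k + 1, t k) (k + 2, t k)), ?_⟩
  ext ⟨i, u⟩ ⟨j, v⟩
  rw [glue_adj]
  dsimp only
  by_cases hij : i = j
  · subst hij
    simp
  · simp only [hij, false_and, false_or, ne_eq, not_false_eq_true, true_and, decide_eq_true_eq]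
    obtain ⟨k, hk, hkij⟩ := exists_eq_of_ne hij
    rw [hk]
    constructor
    · rintro ⟨hH, rfl, rfl⟩
      rcases hkij with ⟨rfl, rfl⟩ | ⟨rfl, rfl⟩
      · exact hH
      · exact hH.symm
    · intro hH
      have hg := h hH
      simp only [glue_adj, hij, false_and, false_or, hk] at hg
      obtain ⟨-, -, rfl, rfl⟩ := hg
      refine ⟨?_, rfl, rfl⟩
      rcases hkij with ⟨rfl, rfl⟩ | ⟨rfl, rfl⟩
      · exact hH
      · exact hH.symm

theorem glue_update_true (k : Fin 3) : glue t F (Function.update K k true) =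
    glue t F (Function.update K k false) ⊔ edge (k + 1, t k) (k + 2, t k) := by
  ext ⟨i, u⟩ ⟨j, v⟩
  rw [sup_adj, edge_adj, glue_adj, glue_adj]
  dsimp only
  by_cases hij : i = j
  · subst hij
    have h₁ : k + 1 ≠ k + 2 := by revert k; decide
    simp only [true_and, Prod.mk.injEq, ne_eq, not_true_eq_false, false_and, or_false]
    constructor
    · exact Or.inl
    · rintro (h | ⟨⟨⟨rfl, -⟩, h, -⟩ | ⟨⟨rfl, -⟩, h, -⟩, -⟩)
      exacts [h, absurd h h₁, absurd h.symm h₁]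
  · obtain ⟨l, hl, hlij⟩ := exists_eq_of_ne hij
    rw [hl]
    have hs : i = k + 1 ∧ j = k + 2 ∨ i = k + 2 ∧ j = k + 1 ↔ l = k := by
      clear * - hlij
      revert i j k l; decide
    by_cases hlk : l = k
    · subst hlk
      clear hl hs
      rcases hlij with ⟨rfl, rfl⟩ | ⟨rfl, rfl⟩ <;> simp [hij]
    · simp only [hij, false_and, false_or, ne_eq, not_false_eq_true, true_and,
        Function.update_of_ne hlk, Prod.mk.injEq]
      tauto

theorem glue_bot_reachable_iff {i j : Fin 3} {u v : V} :
    (glue t F fun _ => false).Reachable (i, u) (j, v) ↔ i = j ∧ (F i).Reachable u v := by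
  constructor
  · suffices ∀ x y, (glue t F fun _ => false).Reachable x y →
        x.1 = y.1 ∧ (F x.1).Reachable x.2 y.2 from this _ _
    rintro x y ⟨p⟩
    induction p with
    | nil => exact ⟨rfl, .rfl⟩
    | cons h p ih =>
      simp only [glue_adj, Bool.false_eq_true, false_and, and_false, or_false] at h
      rw [← h.1] at ih
      exact ⟨ih.1, h.2.reachable.trans ih.2⟩
  · rintro ⟨rfl, h⟩
    exact h.map (⟨fun v => (i, v), fun h => glue_adj_same.2 h⟩ : F i →g glue t F fun _ => false)

theorem glue_bot_isAcyclic_iff :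
    (glue t F fun _ => false).IsAcyclic ↔ ∀ i, (F i).IsAcyclic := by
  constructor
  · intro h i
    exact h.comap (⟨fun v => (i, v), fun h => glue_adj_same.2 h⟩ : F i →g glue t F fun _ => false)
      fun u v huv => congrArg Prod.snd huv
  · intro h
    rw [isAcyclic_iff_forall_adj_isBridge]
    rintro ⟨i, u⟩ ⟨j, v⟩ huv hr
    simp only [glue_adj, Bool.false_eq_true, false_and, and_false, or_false] at huv
    obtain ⟨rfl, huv⟩ := huv
    refine isAcyclic_iff_forall_adj_isBridge.1 (h i) huv ?_
    -- Without connecting edges, deleting an edge of copy `i` affects that copy alone, so a detour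
    -- around the edge would already exist in `F i`.
    have hle : (glue t F fun _ => false).deleteEdges {s((i, u), (i, v))} ≤
        glue t (Function.update F i ((F i).deleteEdges {s(u, v)})) fun _ => false := by
      rintro ⟨j, x⟩ ⟨k, y⟩ hxy
      simp only [deleteEdges_adj, glue_adj, Bool.false_eq_true, false_and, and_false, or_false] at hxy
      obtain ⟨⟨rfl, hxy⟩, hne⟩ := hxy
      rw [glue_adj_same]
      by_cases hj : j = i
      · subst hj
        simpa [hxy] using hne
      · simpa [hj] using hxy
    simpa using (glue_bot_reachable_iff.1 (hr.mono hle)).2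

/-- A walk leaves a copy only through one of its corners. Hence if every component of the glued
forest meets an outer corner, every component inside a copy meets a corner of that copy. -/
theorem exists_reachable_corner_of_glue {x : Fin 3 × V} {j k : Fin 3}
    (h : (glue t F K).Reachable x (j, t k)) : ∃ l, (F x.1).Reachable x.2 (t l) := by
  generalize hy : (j, t k) = y at h
  obtain ⟨p⟩ := h
  induction p with
  | nil => subst hy; exact ⟨k, .rfl⟩
  | cons h p ih =>
    rcases glue_adj.1 h with ⟨hxy, h⟩ | ⟨-, -, h, -⟩
    · obtain ⟨l, hl⟩ := ih hy
      rw [← hxy] at hl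
      exact ⟨l, h.reachable.trans hl⟩
    · exact ⟨_, by rw [← h]⟩

/-! ### Components of the glued graph as decidable labels -/

/-- The graph `G` is acyclic iff `P` holds, and corners are connected in `G` iff their labels
agree. -/
structure IsLabelled (G : SimpleGraph (Fin 3 × V)) (t : Fin 3 → V) (P : Prop)
    (L : Fin 3 × Fin 3 → ℕ) : Prop where
  isAcyclic_iff : G.IsAcyclic ↔ P
  reachable_iff : ∀ x y, G.Reachable (x.1, t x.2) (y.1, t y.2) ↔ L x = L y

/-- The labels of the components after joining the corners `k` of the two copies other than `k`,
provided that `b` holds. -/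
def joinLabels (b : Bool) (k : Fin 3) (L : Fin 3 × Fin 3 → ℕ) : Fin 3 × Fin 3 → ℕ :=
  fun x => if b ∧ L x = L (k + 2, k) then L (k + 1, k) else L x

/-- A new edge closes a cycle exactly when its ends were already connected; otherwise it merges
their two components, which relabelling records. -/
theorem IsLabelled.update {P : Prop} {L : Fin 3 × Fin 3 → ℕ}
    (h : (glue t F K).IsLabelled t P L) (k : Fin 3) (hk : K k = false) (b : Bool) :
    (glue t F (Function.update K k b)).IsLabelled t
      (P ∧ (b = true → L (k + 1, k) ≠ L (k + 2, k))) (joinLabels b k L) := by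
  have hu : Function.update K k false = K := by rw [← hk, Function.update_eq_self]
  cases b with
  | false =>
    rw [hu]
    exact ⟨by simpa using h.isAcyclic_iff, by simpa [joinLabels] using h.reachable_iff⟩
  | true =>
    rw [glue_update_true, hu]
    constructor
    · have hne : k + 1 ≠ k + 2 := by clear * -; revert k; decide
      rw [isAcyclic_sup_fromEdgeSet_iff, h.isAcyclic_iff,
        h.reachable_iff (k + 1, k) (k + 2, k), glue_adj_edge, hk]
      simp [hne]
    · intro x y
      rw [reachable_sup_edge_iff, h.reachable_iff, h.reachable_iff x (k + 1, k),
        h.reachable_iff x (k + 2, k), h.reachable_iff (k + 1, k) y, h.reachable_iff (k + 2, k) y]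
      simp only [joinLabels, true_and]
      split_ifs <;> grind

/-- Labels for the corners of three disjoint copies. -/
def copyLabels (π : Fin 3 → CornerPartition) : Fin 3 × Fin 3 → ℕ :=
  -- Partition labels lie below 3, so the multiples of 3 keep the labels of different copies apart.
  fun x => 3 * x.1 + (π x.1).label x.2

/-- Labels for the corners of the three copies after adding the edges `K`. -/
def glueLabels (π : Fin 3 → CornerPartition) (K : Fin 3 → Bool) : Fin 3 × Fin 3 → ℕ :=
  joinLabels (K 2) 2 (joinLabels (K 1) 1 (joinLabels (K 0) 0 (copyLabels π)))

/-- Adding the edges `K` creates no cycle. -/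
def GlueAcyclic (π : Fin 3 → CornerPartition) (K : Fin 3 → Bool) : Prop :=
  ((K 0 = true → copyLabels π (0 + 1, 0) ≠ copyLabels π (0 + 2, 0)) ∧
    (K 1 = true → joinLabels (K 0) 0 (copyLabels π) (1 + 1, 1) ≠
      joinLabels (K 0) 0 (copyLabels π) (1 + 2, 1))) ∧
    (K 2 = true → joinLabels (K 1) 1 (joinLabels (K 0) 0 (copyLabels π)) (2 + 1, 2) ≠
      joinLabels (K 1) 1 (joinLabels (K 0) 0 (copyLabels π)) (2 + 2, 2))

/-- Gluing forests with corner partitions `π` along the edges `K` gives a forest with corner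
partition `ρ`. -/
def IsGluing (π : Fin 3 → CornerPartition) (K : Fin 3 → Bool) (ρ : CornerPartition) : Prop :=
  GlueAcyclic π K ∧ (∀ x, ∃ i, glueLabels π K x = glueLabels π K (i, i)) ∧
    ∀ i j, glueLabels π K (i, i) = glueLabels π K (j, j) ↔ ρ.label i = ρ.label j

instance (π : Fin 3 → CornerPartition) (K : Fin 3 → Bool) (ρ : CornerPartition) :
    Decidable (IsGluing π K ρ) := by
  unfold IsGluing GlueAcyclic; infer_instance

/-- Starting from disjoint copies, the connecting edges are added one at a time. Acyclicity of the
gluing and its connections among corners thereby become a finite computation with `π` and `K`. -/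
theorem isLabelled_glue {π : Fin 3 → CornerPartition}
    (h : ∀ k i j, (F k).Reachable (t i) (t j) ↔ (π k).label i = (π k).label j) :
    (glue t F K).IsLabelled t ((∀ i, (F i).IsAcyclic) ∧ GlueAcyclic π K) (glueLabels π K) := by
  have h₀ : (glue t F fun _ => false).IsLabelled t (∀ i, (F i).IsAcyclic) (copyLabels π) := by
    refine ⟨glue_bot_isAcyclic_iff, fun x y => ?_⟩
    rw [glue_bot_reachable_iff, h]
    have hx := (π x.1).label_lt x.2
    have hy := (π y.1).label_lt y.2
    simp only [copyLabels]
    constructor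
    · rintro ⟨h₁, h₂⟩
      rw [← h₁, h₂]
    · intro h₁
      have h₂ : x.1 = y.1 := by ext; omega
      rw [← h₂] at h₁ ⊢
      exact ⟨rfl, by omega⟩
  have h₃ := ((h₀.update 0 rfl (K 0)).update 1 rfl (K 1)).update 2 rfl (K 2)
  have hK : Function.update (Function.update (Function.update (fun _ => false) 0 (K 0)) 1 (K 1))
      2 (K 2) = K := by
    ext i
    fin_cases i <;> rfl
  rw [hK] at h₃
  exact ⟨h₃.isAcyclic_iff.trans (by simp only [GlueAcyclic, and_assoc]), h₃.reachable_iff⟩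

theorem isCornerForest_glue {π : Fin 3 → CornerPartition} {ρ : CornerPartition}
    (hF : ∀ i, (F i).IsCornerForest t (π i)) (h : IsGluing π K ρ) :
    (glue t F K).IsCornerForest (fun i => (i, t i)) ρ := by
  have hl := isLabelled_glue (K := K) fun k => (hF k).reachable_iff
  obtain ⟨h₁, h₂, h₃⟩ := h
  refine ⟨hl.isAcyclic_iff.2 ⟨fun i => (hF i).isAcyclic, h₁⟩, ?_, fun i j => ?_⟩
  · rintro ⟨i, v⟩
    obtain ⟨j, hj⟩ := (hF i).exists_reachable v
    obtain ⟨k, hk⟩ := h₂ (i, j)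
    have h₄ : (glue t F fun _ => false).Reachable (i, v) (i, t j) :=
      glue_bot_reachable_iff.2 ⟨rfl, hj⟩
    exact ⟨k, (h₄.mono (glue_le_glue_iff.2 ⟨le_rfl, fun _ => Bool.false_le _⟩)).trans
      ((hl.reachable_iff (i, j) (k, k)).2 hk)⟩
  · exact (hl.reachable_iff (i, i) (j, j)).trans (h₃ i j)

theorem IsCornerForest.exists_of_glue {ρ : CornerPartition}
    (h : (glue t F K).IsCornerForest (fun i => (i, t i)) ρ) :
    ∃ π : Fin 3 → CornerPartition, (∀ i, (F i).IsCornerForest t (π i)) ∧ IsGluing π K ρ := by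
  have he : ∀ k, ∃ π : CornerPartition,
      ∀ i j, (F k).Reachable (t i) (t j) ↔ π.label i = π.label j := fun k =>
    CornerPartition.exists_label (r := fun i j => (F k).Reachable (t i) (t j))
      ⟨fun _ => .rfl, Reachable.symm, Reachable.trans⟩
  choose π hπ using he
  have hl := isLabelled_glue (K := K) hπ
  obtain ⟨h₁, h₂⟩ := hl.isAcyclic_iff.1 h.isAcyclic
  refine ⟨π, fun i => ⟨h₁ i, fun v => ?_, hπ i⟩, h₂, fun x => ?_, fun i j => ?_⟩
  · obtain ⟨j, hj⟩ := h.exists_reachable (i, v)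
    exact exists_reachable_corner_of_glue hj
  · obtain ⟨i, hi⟩ := h.exists_reachable (x.1, t x.2)
    exact ⟨i, (hl.reachable_iff x (i, i)).1 hi⟩
  · exact (hl.reachable_iff (i, i) (j, j)).symm.trans (h.reachable_iff i j)

/-! ### The counting recursion -/

/-- A spanning forest of three copies of `G`, joined in a ring, consists of spanning forests of the
copies and a set of connecting edges. -/
noncomputable def cornerForestsGlueEquiv (G : SimpleGraph V) (t : Fin 3 → V)
    (ρ : CornerPartition) :
    ((c : {c : (Fin 3 → CornerPartition) × (Fin 3 → Bool) // IsGluing c.1 c.2 ρ}) ×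
      ((i : Fin 3) → cornerForests G t (c.1.1 i))) ≃
      cornerForests (glue t (fun _ => G) fun _ => true) (fun i => (i, t i)) ρ :=
  Equiv.ofBijective
    (fun x => ⟨glue t (fun i => x.2 i) x.1.1.2,
      glue_le_glue_iff.2 ⟨fun i => (x.2 i).2.1, fun _ => Bool.le_true _⟩,
      isCornerForest_glue (fun i => (x.2 i).2.2) x.1.2⟩) <| by
    constructor
    · rintro ⟨⟨⟨π, K⟩, hc⟩, F⟩ ⟨⟨⟨π', K'⟩, hc'⟩, F'⟩ h
      obtain ⟨hF, hK⟩ :=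
        glue_injective (show glue t (fun i => F i) K = glue t (fun i => F' i) K' from
          congrArg Subtype.val h)
      obtain rfl : K = K' := hK
      -- A forest determines the partition it induces, so the index `π` is recovered from the
      -- forests.
      obtain rfl : π = π' := funext fun i =>
        (F i).2.2.eq (by rw [show (F i : SimpleGraph V) = F' i from congrFun hF i]; exact (F' i).2.2)
      obtain rfl : F = F' := funext fun i => Subtype.ext (congrFun hF i)
      rfl
    · rintro ⟨H, hle, hH⟩
      obtain ⟨F, K, rfl⟩ := exists_glue_eq_of_le hle
      obtain ⟨π, hF, hc⟩ := hH.exists_of_glue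
      exact ⟨⟨⟨(π, K), hc⟩, fun i => ⟨F i, (glue_le_glue_iff.1 hle).1 i, hF i⟩⟩, rfl⟩

theorem ncard_cornerForests_glue [Finite V] (G : SimpleGraph V) (t : Fin 3 → V)
    (ρ : CornerPartition) :
    (cornerForests (glue t (fun _ => G) fun _ => true) (fun i => (i, t i)) ρ).ncard =
      ∑ c : (Fin 3 → CornerPartition) × (Fin 3 → Bool) with IsGluing c.1 c.2 ρ,
        ∏ i, (cornerForests G t (c.1 i)).ncard := by
  rw [← Nat.card_coe_set_eq, ← Nat.card_congr (cornerForestsGlueEquiv G t ρ), Nat.card_sigma]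
  simp only [Nat.card_pi, Nat.card_coe_set_eq]
  exact (Finset.sum_subtype (p := fun c : (Fin 3 → CornerPartition) × (Fin 3 → Bool) =>
    IsGluing c.1 c.2 ρ) _ (fun c => Finset.mem_filter_univ c)
    fun c => ∏ i, (cornerForests G t (c.1 i)).ncard).symm

/-! ### The recursion on the invariant family s = τr, q = 3τr² -/

/-- The coefficient `w` of `τ * (w * r ^ d)`, the number of spanning forests with a given corner
partition in a graph with parameters `τ` and `r`. -/
def _root_.CornerPartition.weight : CornerPartition → ℕ
  | some none => 3
  | _ => 1

/-- The exponent `d` of `τ * (w * r ^ d)`, which is the number of blocks minus one. -/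
def _root_.CornerPartition.degree : CornerPartition → ℕ
  | none => 0
  | some (some _) => 1
  | some none => 2

theorem _root_.CornerPartition.degree_le (π : CornerPartition) : π.degree ≤ 2 := by
  revert π; decide

/-- The total weight of the gluings of total degree `d` with result `ρ`. -/
def gluingWeight (ρ : CornerPartition) (d : ℕ) : ℕ :=
  ∑ c : (Fin 3 → CornerPartition) × (Fin 3 → Bool) with IsGluing c.1 c.2 ρ,
    if ∑ i, (c.1 i).degree = d then ∏ i, (c.1 i).weight else 0

theorem sum_isGluing_prod {x : CornerPartition → ℝ} {τ r : ℝ}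
    (hx : ∀ π : CornerPartition, x π = τ * (π.weight * r ^ π.degree)) (ρ : CornerPartition) :
    ∑ c : (Fin 3 → CornerPartition) × (Fin 3 → Bool) with IsGluing c.1 c.2 ρ, ∏ i, x (c.1 i) =
      τ ^ 3 * ∑ d ∈ Finset.range 7, gluingWeight ρ d * r ^ d := by
  simp only [gluingWeight, Nat.cast_sum, Finset.sum_mul]
  rw [Finset.sum_comm, Finset.mul_sum]
  refine Finset.sum_congr rfl fun c _ => ?_
  -- Three degrees of at most 2 sum to at most 6.
  have hc : ∑ i, (c.1 i).degree ∈ Finset.range 7 := by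
    rw [Fin.sum_univ_three, Finset.mem_range]
    have := (c.1 0).degree_le
    have := (c.1 1).degree_le
    have := (c.1 2).degree_le
    omega
  simp only [hx, Nat.cast_ite, Nat.cast_zero, ite_mul, zero_mul]
  rw [Finset.sum_ite_eq, if_pos hc, Finset.prod_mul_distrib, Finset.prod_mul_distrib,
    Finset.prod_pow_eq_pow_sum]
  simp

theorem sum_fin_three_arrow {α M : Type*} [Fintype α] [AddCommMonoid M] (g : (Fin 3 → α) → M) :
    ∑ f, g f = ∑ a, ∑ b, ∑ c, g ![a, b, c] := by
  let e : α × α × α ≃ (Fin 3 → α) :=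
    { toFun := fun p => ![p.1, p.2.1, p.2.2]
      invFun := fun f => (f 0, f 1, f 2)
      left_inv := fun p => rfl
      right_inv := fun f => by ext i; fin_cases i <;> rfl }
  rw [← e.sum_comp, Fintype.sum_prod_type]
  simp only [Fintype.sum_prod_type]
  rfl

/-- Nested sums over single partitions and edges, with the degree test before the gluing test, are a
form that evaluation can handle: 5³ · 2³ cases. -/
theorem gluingWeight_eq (ρ : CornerPartition) (d : ℕ) : gluingWeight ρ d =
    ∑ p : CornerPartition, ∑ q : CornerPartition, ∑ r : CornerPartition,
      ∑ k : Bool, ∑ l : Bool, ∑ m : Bool,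
        if p.degree + q.degree + r.degree = d ∧ IsGluing ![p, q, r] ![k, l, m] ρ then
          p.weight * q.weight * r.weight else 0 := by
  rw [gluingWeight, Finset.sum_filter, Fintype.sum_prod_type]
  simp only [sum_fin_three_arrow, Fin.sum_univ_three, Fin.prod_univ_three, ← ite_and,
    and_comm (a := _ = d)]
  rfl

set_option maxRecDepth 10000 in
-- The 3 counts three trees with two of the connecting edges. The 6 counts all three edges: the ring
-- must be broken in one copy, by separating one of the two corners through which the ring passes,
-- which gives 3 · 2 choices.
theorem gluingWeight_none : ∀ d ∈ Finset.range 7,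
    gluingWeight none d = [3, 6, 0, 0, 0, 0, 0].getD d 0 := by
  simp only [gluingWeight_eq]
  decide +kernel

set_option maxRecDepth 10000 in
theorem gluingWeight_some_some : ∀ k, ∀ d ∈ Finset.range 7,
    gluingWeight (some (some k)) d = [1, 7, 10, 0, 0, 0, 0].getD d 0 := by
  simp only [gluingWeight_eq]
  decide +kernel

set_option maxRecDepth 10000 in
theorem gluingWeight_some_none : ∀ d ∈ Finset.range 7,
    gluingWeight (some none) d = [1, 12, 45, 50, 0, 0, 0].getD d 0 := by
  simp only [gluingWeight_eq]
  decide +kernel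

/-- The three weight polynomials share the factor 1 + 2r: 1 + 7r + 10r² = (1+2r)(1+5r) and 1 + 12r +
45r² + 50r³ = (1+2r)(1+5r)². This is why the family is invariant. -/
theorem sum_isGluing_eq {x : CornerPartition → ℝ} {τ r : ℝ}
    (hx : ∀ π : CornerPartition, x π = τ * (π.weight * r ^ π.degree)) (ρ : CornerPartition) :
    ∑ c : (Fin 3 → CornerPartition) × (Fin 3 → Bool) with IsGluing c.1 c.2 ρ, ∏ i, x (c.1 i) =
      3 * τ ^ 3 * (1 + 2 * r) * (ρ.weight * ((5 * r + 1) / 3) ^ ρ.degree) := by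
  rw [sum_isGluing_prod hx]
  rcases ρ with _ | _ | k
  · rw [Finset.sum_congr rfl fun d hd => by rw [gluingWeight_none d hd]]
    simp [Finset.sum_range_succ, CornerPartition.weight, CornerPartition.degree]
    ring
  · rw [Finset.sum_congr rfl fun d hd => by rw [gluingWeight_some_none d hd]]
    simp [Finset.sum_range_succ, CornerPartition.weight, CornerPartition.degree]
    ring
  · rw [Finset.sum_congr rfl fun d hd => by rw [gluingWeight_some_some k d hd]]
    simp [Finset.sum_range_succ, CornerPartition.weight, CornerPartition.degree]
    ring

/-! ### Transport along bijections, and the forests of the theorem as corner forests -/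

variable {W : Type*}

theorem isCornerForest_comap_iff (e : V ≃ W) {F : SimpleGraph W} {t : Fin 3 → V}
    {π : CornerPartition} :
    (F.comap e).IsCornerForest t π ↔ F.IsCornerForest (fun i => e (t i)) π := by
  have hr : ∀ u v, (F.comap e).Reachable u v ↔ F.Reachable (e u) (e v) :=
    fun u v => (Iso.comap e F).reachable_iff.symm
  constructor
  · rintro ⟨h₁, h₂, h₃⟩
    refine ⟨(Iso.comap e F).isAcyclic_iff.1 h₁, fun w => ?_, fun i j => ?_⟩
    · obtain ⟨i, hi⟩ := h₂ (e.symm w)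
      exact ⟨i, by simpa [hr] using hi⟩
    · rw [← hr, h₃]
  · rintro ⟨h₁, h₂, h₃⟩
    refine ⟨(Iso.comap e F).isAcyclic_iff.2 h₁, fun v => ?_, fun i j => ?_⟩
    · obtain ⟨i, hi⟩ := h₂ (e v)
      exact ⟨i, (hr _ _).2 hi⟩
    · rw [hr, h₃]

theorem ncard_cornerForests_comap (e : V ≃ W) (G : SimpleGraph W) (t : Fin 3 → V)
    (π : CornerPartition) :
    (cornerForests (G.comap e) t π).ncard = (cornerForests G (fun i => e (t i)) π).ncard := by
  have h : cornerForests (G.comap e) t π =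
      e.symm.simpleGraph '' cornerForests G (fun i => e (t i)) π := by
    ext F
    rw [Equiv.image_eq_preimage_symm]
    simp only [cornerForests, Set.mem_ofPred_eq, Set.mem_preimage, ← isCornerForest_comap_iff]
    have hF : (e.symm.simpleGraph.symm F).comap e = F := by ext; simp
    rw [hF]
    refine and_congr_left' ⟨fun h u v huv => ?_, fun h u v huv => ?_⟩
    · simpa using h (v := e.symm u) (w := e.symm v) (by simpa using huv)
    · exact h (by simpa using huv)
  rw [h, Set.ncard_image_of_injective _ (Equiv.injective _)]

theorem spanningTrees_eq (G : SimpleGraph V) (t : Fin 3 → V) :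
    spanningTrees G = cornerForests G t none := by
  ext F
  refine and_congr_right fun _ => ⟨fun h => ⟨h.isAcyclic, fun v => ⟨0, h.connected v _⟩,
    fun i j => ⟨fun _ => rfl, fun _ => h.connected _ _⟩⟩, fun h => ?_⟩
  have : Nonempty V := ⟨t 0⟩
  refine ⟨⟨fun u v => ?_⟩, h.isAcyclic⟩
  obtain ⟨i, hi⟩ := h.exists_reachable u
  obtain ⟨j, hj⟩ := h.exists_reachable v
  exact hi.trans (((h.reachable_iff i j).2 rfl).trans hj.symm)

theorem label_some_some_iff {i j k : Fin 3} :
    CornerPartition.label (some (some i)) j = CornerPartition.label (some (some i)) k ↔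
      (j = i ↔ k = i) := by
  revert i j k; decide

theorem setOf_separating_forests_eq [Finite V] (G : SimpleGraph V) (t : Fin 3 → V) (i : Fin 3) :
    {F | F ∈ spanningForests G 2 ∧
      (∀ j k, j ≠ i → k ≠ i → F.Reachable (t j) (t k)) ∧
      (∀ j, j ≠ i → ¬ F.Reachable (t i) (t j))} = cornerForests G t (some (some i)) := by
  ext F
  have hi : i + 1 ≠ i := by revert i; decide
  -- Corner `i` and corner `i + 1` represent the two components; with exactly two components,
  -- injectivity of `f` makes every component contain a corner.
  let f : Bool → F.ConnectedComponent := fun b =>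
    F.connectedComponentMk (t (if b then i else i + 1))
  have hinj : ¬ F.Reachable (t i) (t (i + 1)) → f.Injective := by
    intro h b c hbc
    have := ConnectedComponent.eq.1 hbc
    cases b <;> cases c <;> simp at this ⊢
    exacts [h this.symm, h this]
  constructor
  · rintro ⟨⟨hle, hac, hcard⟩, h₁, h₂⟩
    refine ⟨hle, hac, fun v => ?_, fun j k => ?_⟩
    · have hf : f.Bijective := (Nat.bijective_iff_injective_and_card f).2
        ⟨hinj (h₂ _ hi), by simp [hcard]⟩
      obtain ⟨b, hb⟩ := hf.2 (F.connectedComponentMk v)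
      exact ⟨_, (ConnectedComponent.eq.1 hb).symm⟩
    · rw [label_some_some_iff]
      by_cases hj : j = i <;> by_cases hk : k = i
      · simp [hj, hk]
      · subst hj; simpa [hk] using h₂ k hk
      · subst hk; simpa [hj] using fun h => h₂ j hj h.symm
      · simpa [hj, hk] using h₁ j k hj hk
  · rintro ⟨hle, hac, h₁, h₂⟩
    have hn : ∀ j, j ≠ i → ¬ F.Reachable (t i) (t j) := fun j hj => by
      simp [h₂, label_some_some_iff, hj]
    have hr : ∀ j k, j ≠ i → k ≠ i → F.Reachable (t j) (t k) := fun j k hj hk => by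
      simp [h₂, label_some_some_iff, hj, hk]
    refine ⟨⟨hle, hac, ?_⟩, hr, hn⟩
    have hf : f.Bijective := by
      refine ⟨hinj (hn _ hi), ConnectedComponent.ind fun v => ?_⟩
      obtain ⟨j, hj⟩ := h₁ v
      refine ⟨decide (j = i), ConnectedComponent.eq.2 (.trans ?_ hj.symm)⟩
      by_cases h : j = i
      · simp [h]
      · simpa [h] using hr _ _ hi h
    rw [← Nat.card_eq_of_bijective f hf]
    simp

/-- The condition makes the map from corners to components bijective, so the count of three
components is automatic. -/
theorem setOf_rooted_forests_eq (G : SimpleGraph V) (t : Fin 3 → V) :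
    {F | F ∈ spanningForests G 3 ∧ ∀ C : F.ConnectedComponent, ∃! i : Fin 3, t i ∈ C.supp} =
      cornerForests G t (some none) := by
  ext F
  have hl : ∀ i j : Fin 3, CornerPartition.label (some none) i =
      CornerPartition.label (some none) j ↔ i = j := by decide
  have hb : (∀ C : F.ConnectedComponent, ∃! i : Fin 3, t i ∈ C.supp) ↔
      Function.Bijective fun i => F.connectedComponentMk (t i) := by
    simp [Function.bijective_iff_existsUnique]
  simp only [Set.mem_ofPred_eq, hb]
  constructor
  · rintro ⟨⟨hle, hac, -⟩, h₁, h₂⟩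
    refine ⟨hle, hac, fun v => ?_, fun i j => ?_⟩
    · obtain ⟨i, hi⟩ := h₂ (F.connectedComponentMk v)
      exact ⟨i, (ConnectedComponent.eq.1 hi).symm⟩
    · rw [hl, ← h₁.eq_iff, ConnectedComponent.eq]
  · rintro ⟨hle, hac, h₁, h₂⟩
    have hf : Function.Bijective fun i => F.connectedComponentMk (t i) := by
      refine ⟨fun i j h => (hl i j).1 ((h₂ i j).1 (ConnectedComponent.eq.1 h)),
        ConnectedComponent.ind fun v => ?_⟩
      obtain ⟨i, hi⟩ := h₁ v
      exact ⟨i, ConnectedComponent.eq.2 hi.symm⟩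
    exact ⟨⟨hle, hac, by rw [← Nat.card_eq_of_bijective _ hf, Nat.card_fin]⟩, hf⟩

end SimpleGraph

open SimpleGraph

/-! ### Self-similarity of the Schreier graphs -/

/-- The generator of the Hanoi Towers group that fixes the letter `k`. -/
def hanoiGenerator (k : Fin 3) (n : ℕ) : Equiv.Perm (HanoiWord n) :=
  hanoiPerm (Equiv.swap (k + 1) (k + 2)) k n

theorem hanoiGraph_adj {n : ℕ} {u v : HanoiWord n} : (hanoiGraph n).Adj u v ↔
    u ≠ v ∧ ∃ k, hanoiGenerator k n u = v ∨ hanoiGenerator k n v = u := by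
  have hA : hanoiA n = hanoiGenerator 2 n := rfl
  have hB : hanoiB n = hanoiGenerator 1 n := by
    rw [hanoiB, Equiv.swap_comm]; rfl
  have hC : hanoiC n = hanoiGenerator 0 n := rfl
  rw [hanoiGraph, schreierGraph, fromRel_adj, hA, hB, hC]
  simp only [Set.mem_insert_iff, Set.mem_singleton_iff, exists_eq_or_imp, exists_eq_left,
    Fin.exists_fin_succ]
  simp
  tauto

theorem hanoiMap_corner {σ : Equiv.Perm (Fin 3)} {x : Fin 3} (hσ : σ x = x) (n : ℕ) :
    hanoiMap σ x n (hanoiCorner n x) = hanoiCorner n x := by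
  induction n with
  | zero => rfl
  | succ n ih =>
    have ht : Fin.tail (hanoiCorner (n + 1) x) = hanoiCorner n x := rfl
    rw [hanoiMap, ht, ih]
    ext i
    refine Fin.cases ?_ (fun i => ?_) i <;> simp [hanoiCorner, hσ]

/-- The recursion descends only through letters equal to `x`, so it reaches the last letter exactly
when the prefix is all `x`; that prefix is then fixed because `σ` fixes `x`. -/
theorem hanoiMap_snoc {σ : Equiv.Perm (Fin 3)} {x : Fin 3} (hσ : σ x = x) (n : ℕ)
    (w : HanoiWord n) (j : Fin 3) :
    hanoiMap σ x (n + 1) (Fin.snoc w j : HanoiWord (n + 1)) =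
      if w = hanoiCorner n x then (Fin.snoc w (σ j) : HanoiWord (n + 1))
      else (Fin.snoc (hanoiMap σ x n w) j : HanoiWord (n + 1)) := by
  induction n with
  | zero =>
    rw [if_pos (Subsingleton.elim _ _)]
    ext i
    fin_cases i
    simp [hanoiMap, Fin.snoc]
  | succ n ih =>
    have hw : w = (Fin.cons (w 0) (Fin.tail w) : HanoiWord (n + 1)) := (Fin.cons_self_tail w).symm
    generalize hy : w 0 = y at hw
    generalize hv : Fin.tail w = v at hw
    subst hw
    have hc : (Fin.cons y v : HanoiWord (n + 1)) = hanoiCorner (n + 1) x ↔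
        y = x ∧ v = hanoiCorner n x := by
      have : hanoiCorner (n + 1) x = (Fin.cons x (hanoiCorner n x) : HanoiWord (n + 1)) := by
        ext i
        refine Fin.cases ?_ (fun i => ?_) i <;> simp [hanoiCorner]
      rw [this, Fin.cons_inj]
    have hs : ∀ (y : Fin 3) (v : HanoiWord n) (j : Fin 3),
        (Fin.snoc (Fin.cons y v : HanoiWord (n + 1)) j : HanoiWord (n + 2)) =
          (Fin.cons y (Fin.snoc v j : HanoiWord (n + 1)) : HanoiWord (n + 2)) := fun y v j =>
      (Fin.cons_snoc_eq_snoc_cons (β := Fin 3) y v j).symm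
    simp only [hc, hs]
    rw [hanoiMap]
    simp only [Fin.cons_zero, Fin.tail_cons]
    by_cases hyx : y = x
    · subst hyx
      simp only [if_true, true_and, ih]
      by_cases h : v = hanoiCorner n y
      · simp [h, hσ]
      · simp [h, hanoiMap, hs]
    · simp [hyx, hanoiMap, hs]

theorem hanoiGenerator_fix (k : Fin 3) : Equiv.swap (k + 1) (k + 2) k = k := by
  revert k; decide

theorem hanoiGenerator_snoc_eq_iff {k : Fin 3} {n : ℕ} {u v : HanoiWord n} {i j : Fin 3} :
    hanoiGenerator k (n + 1) (Fin.snoc u i : HanoiWord (n + 1)) =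
        (Fin.snoc v j : HanoiWord (n + 1)) ↔
      (u = hanoiCorner n k ∧ u = v ∧ Equiv.swap (k + 1) (k + 2) i = j) ∨
        (u ≠ hanoiCorner n k ∧ hanoiGenerator k n u = v ∧ i = j) := by
  have h := hanoiMap_snoc (hanoiGenerator_fix k) n u i
  change hanoiGenerator k (n + 1) _ = _ at h
  rw [h]
  split_ifs with hu
  · simp [hu, Fin.snoc_inj]
  · simp only [hu, Fin.snoc_inj, false_and, ne_eq, not_false_eq_true, true_and, false_or]
    rfl

/-- A word of length `n + 1` consists of its last letter and the word of its first `n` letters. -/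
def hanoiWordEquiv (n : ℕ) : Fin 3 × HanoiWord n ≃ HanoiWord (n + 1) :=
  Fin.snocEquiv fun _ => Fin 3

theorem hanoiWordEquiv_apply (n : ℕ) (x : Fin 3 × HanoiWord n) :
    hanoiWordEquiv n x = (Fin.snoc x.2 x.1 : HanoiWord (n + 1)) :=
  rfl

theorem hanoiWordEquiv_corner (n : ℕ) (i : Fin 3) :
    hanoiWordEquiv n (i, hanoiCorner n i) = hanoiCorner (n + 1) i := by
  rw [hanoiWordEquiv_apply]
  ext j
  refine Fin.lastCases ?_ (fun j => ?_) j <;> simp [hanoiCorner]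

/-- Generator k fixes k^n, giving a loop of Σ_n. One level up, the loops at k^n in the two copies
other than k open into one edge joining these copies; all other moves stay within a copy. -/
theorem hanoiGraph_comap (n : ℕ) : (hanoiGraph (n + 1)).comap (hanoiWordEquiv n) =
    glue (hanoiCorner n) (fun _ => hanoiGraph n) fun _ => true := by
  ext ⟨i, u⟩ ⟨j, v⟩
  rw [comap_adj, hanoiGraph_adj, glue_adj, hanoiGraph_adj]
  simp only [hanoiWordEquiv_apply, hanoiGenerator_snoc_eq_iff, ne_eq, Fin.snoc_inj]
  by_cases hij : i = j
  · subst hij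
    simp only [and_true, true_and, not_true_eq_false, false_and, or_false]
    refine and_congr_right fun huv => exists_congr fun k => ?_
    have hfix : hanoiGenerator k n (hanoiCorner n k) = hanoiCorner n k :=
      hanoiMap_corner (hanoiGenerator_fix k) n
    constructor
    · rintro ((⟨-, h, -⟩ | ⟨-, h⟩) | (⟨-, h, -⟩ | ⟨-, h⟩))
      exacts [absurd h huv, Or.inl h, absurd h.symm huv, Or.inr h]
    · rintro (h | h)
      · exact Or.inl (Or.inr ⟨fun hu => huv (by rw [← h, hu, hfix]), h⟩)
      · exact Or.inr (Or.inr ⟨fun hu => huv (by rw [← h, hu, hfix]), h⟩)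
  · have h₁ : ∀ k, Equiv.swap (k + 1) (k + 2) i = j ↔ k = -(i + j) := by
      revert i j; decide
    have h₂ : ∀ k, Equiv.swap (k + 1) (k + 2) j = i ↔ k = -(i + j) := by
      revert i j; decide
    simp only [h₁, h₂, hij, Ne.symm hij, and_false, or_false, not_false_eq_true, true_and,
      false_and, false_or]
    constructor
    · rintro ⟨k, ⟨h, h', rfl⟩ | ⟨h, h', rfl⟩⟩
      · exact ⟨h, h' ▸ h⟩
      · exact ⟨h' ▸ h, h⟩
    · rintro ⟨hu, hv⟩
      exact ⟨_, Or.inl ⟨hu, hu.trans hv.symm, rfl⟩⟩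

/-! ### Closed forms and the growth constant -/

/-- The number of spanning forests of `Σ_n`, each component of which contains an outmost vertex,
that induce the partition `π` on the outmost vertices. -/
noncomputable def hanoiCount (n : ℕ) (π : CornerPartition) : ℕ :=
  (cornerForests (hanoiGraph n) (hanoiCorner n) π).ncard

theorem hanoiTau_eq (n : ℕ) : hanoiTau n = hanoiCount n none :=
  congrArg Set.ncard (spanningTrees_eq _ _)

theorem hanoiS_eq (n : ℕ) (i : Fin 3) : hanoiS n i = hanoiCount n (some (some i)) :=
  congrArg Set.ncard (setOf_separating_forests_eq _ _ _)

theorem hanoiQ_eq (n : ℕ) : hanoiQ n = hanoiCount n (some none) :=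
  congrArg Set.ncard (setOf_rooted_forests_eq _ _)

theorem hanoiCount_succ (n : ℕ) (ρ : CornerPartition) : hanoiCount (n + 1) ρ =
    ∑ c : (Fin 3 → CornerPartition) × (Fin 3 → Bool) with IsGluing c.1 c.2 ρ,
      ∏ i, hanoiCount n (c.1 i) := by
  simp only [hanoiCount, ← ncard_cornerForests_glue, ← hanoiGraph_comap,
    ncard_cornerForests_comap, hanoiWordEquiv_corner]

/-- On the single vertex of level 0 all corners coincide, so only the one-block partition occurs. -/
theorem hanoiCount_zero (π : CornerPartition) : hanoiCount 0 π = if π = none then 1 else 0 := by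
  have hr : ∀ (F : SimpleGraph (HanoiWord 0)) u v, F.Reachable u v := fun F u v =>
    Subsingleton.elim u v ▸ .rfl
  split_ifs with h
  · subst h
    rw [hanoiCount, Set.ncard_eq_one]
    refine ⟨⊥, Set.eq_singleton_iff_unique_mem.2 ⟨⟨bot_le, isAcyclic_bot, fun v => ⟨0, hr _ _ _⟩,
      fun i j => ⟨fun _ => rfl, fun _ => hr _ _ _⟩⟩, fun F _ => Subsingleton.elim _ _⟩⟩
  · rw [hanoiCount, Set.ncard_eq_zero]
    refine Set.eq_empty_of_forall_notMem fun F hF => h (CornerPartition.label_injective fun i j => ?_)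
    rw [← hF.2.reachable_iff]
    exact ⟨fun _ => rfl, fun _ => hr _ _ _⟩

/-- The closed form of the complexity of `Σ_n`. -/
noncomputable def hanoiComplexity (n : ℕ) : ℝ :=
  (3 : ℝ) ^ (((3 : ℝ) ^ n + 2 * (n : ℝ) - 1) / 4) * (5 : ℝ) ^ (((3 : ℝ) ^ n - 2 * (n : ℝ) - 1) / 4)

theorem hanoiComplexity_succ (n : ℕ) :
    hanoiComplexity (n + 1) = 3 * hanoiComplexity n ^ 3 * (5 / 3) ^ n := by
  -- The factor 3^n on the left clears the denominator of (5/3)^n.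
  have h3 : (3 : ℝ) ^ (((3 : ℝ) ^ (n + 1) + 2 * ((n + 1 : ℕ) : ℝ) - 1) / 4) * 3 ^ n =
      3 * ((3 : ℝ) ^ (((3 : ℝ) ^ n + 2 * (n : ℝ) - 1) / 4)) ^ 3 := by
    have h : ∀ x : ℝ, (3 : ℝ) * 3 ^ x = 3 ^ (1 + x) := fun x => by
      rw [Real.rpow_add (by norm_num), Real.rpow_one]
    rw [← Real.rpow_natCast 3 n, ← Real.rpow_mul_natCast (by norm_num),
      ← Real.rpow_add (by norm_num), h]
    congr 1
    push_cast
    rw [Real.rpow_natCast]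
    ring
  have h5 : (5 : ℝ) ^ (((3 : ℝ) ^ (n + 1) - 2 * ((n + 1 : ℕ) : ℝ) - 1) / 4) =
      ((5 : ℝ) ^ (((3 : ℝ) ^ n - 2 * (n : ℝ) - 1) / 4)) ^ 3 * 5 ^ n := by
    rw [← Real.rpow_natCast 5 n, ← Real.rpow_mul_natCast (by norm_num),
      ← Real.rpow_add (by norm_num)]
    congr 1
    push_cast
    ring
  rw [hanoiComplexity, hanoiComplexity, h5, div_pow]
  generalize (5 : ℝ) ^ (((3 : ℝ) ^ n - 2 * (n : ℝ) - 1) / 4) = B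
  rw [mul_pow, ← mul_assoc 3, ← h3]
  field_simp

/-- The value r = ((5/3)^n - 1)/2 solves r ↦ (5r+1)/3 from r = 0, and 1 + 2r = (5/3)^n is the factor
in `hanoiComplexity_succ`. -/
theorem hanoiCount_eq (n : ℕ) (π : CornerPartition) : (hanoiCount n π : ℝ) =
    hanoiComplexity n * (π.weight * ((((5 / 3) ^ n - 1) / 2 : ℝ)) ^ π.degree) := by
  induction n generalizing π with
  | zero =>
    rcases π with _ | _ | k <;>
      simp [hanoiCount_zero, hanoiComplexity, CornerPartition.weight, CornerPartition.degree]
  | succ n ih =>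
    rw [hanoiCount_succ]
    push_cast
    rw [sum_isGluing_eq ih, hanoiComplexity_succ]
    congr 1
    · ring
    · congr 2
      ring

theorem hanoiTau_eq_hanoiComplexity (n : ℕ) : (hanoiTau n : ℝ) = hanoiComplexity n := by
  rw [hanoiTau_eq, hanoiCount_eq]
  simp [CornerPartition.weight, CornerPartition.degree]

theorem log_hanoiComplexity (n : ℕ) : Real.log (hanoiComplexity n) =
    ((3 : ℝ) ^ n + 2 * (n : ℝ) - 1) / 4 * Real.log 3 +
      ((3 : ℝ) ^ n - 2 * (n : ℝ) - 1) / 4 * Real.log 5 := by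
  rw [hanoiComplexity, Real.log_mul (by positivity) (by positivity), Real.log_rpow (by norm_num),
    Real.log_rpow (by norm_num)]

theorem tendsto_log_hanoiTau_div_card : Filter.Tendsto
    (fun n : ℕ => Real.log (hanoiTau n : ℝ) / (Fintype.card (HanoiWord n) : ℝ))
    Filter.atTop (nhds ((Real.log 3 + Real.log 5) / 4)) := by
  have h₁ : Filter.Tendsto (fun n : ℕ => (n : ℝ) / 3 ^ n) Filter.atTop (nhds 0) := by
    simpa using tendsto_pow_const_div_const_pow_of_one_lt 1 (r := (3 : ℝ)) (by norm_num)
  have h₂ : Filter.Tendsto (fun n : ℕ => (1 / 3 : ℝ) ^ n) Filter.atTop (nhds 0) :=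
    tendsto_pow_atTop_nhds_zero_of_lt_one (by norm_num) (by norm_num)
  -- Divided by 3^n, the exponents of 3 and 5 become (1 ± 2n/3^n - 1/3^n)/4.
  have h := (((h₁.const_mul 2).const_add 1).sub h₂).div_const 4 |>.mul_const (Real.log 3) |>.add
    ((((h₁.const_mul 2).const_sub 1).sub h₂).div_const 4 |>.mul_const (Real.log 5))
  convert h using 1
  · ext n
    rw [hanoiTau_eq_hanoiComplexity, log_hanoiComplexity]
    simp only [Fintype.card_pi, Fintype.card_fin, Finset.prod_const, Finset.card_univ]
    push_cast
    rw [div_pow, one_pow]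
    field_simp
  · congr 1
    ring

theorem mainTheorem5 :
    (∀ n : ℕ, 1 ≤ n →
      (hanoiTau n : ℝ) =
          (3 : ℝ) ^ (((3 : ℝ) ^ n + 2 * (n : ℝ) - 1) / 4) *
          (5 : ℝ) ^ (((3 : ℝ) ^ n - 2 * (n : ℝ) - 1) / 4) ∧
      (∀ i : Fin 3, (hanoiS n i : ℝ) =
          (3 : ℝ) ^ (((3 : ℝ) ^ n - 2 * (n : ℝ) - 1) / 4) *
          (5 : ℝ) ^ (((3 : ℝ) ^ n - 2 * (n : ℝ) - 1) / 4) *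
          (((5 : ℝ) ^ n - (3 : ℝ) ^ n) / 2)) ∧
      (hanoiQ n : ℝ) =
          (3 : ℝ) ^ (((3 : ℝ) ^ n - 6 * (n : ℝ) + 3) / 4) *
          (5 : ℝ) ^ (((3 : ℝ) ^ n - 2 * (n : ℝ) - 1) / 4) *
          (((5 : ℝ) ^ n - (3 : ℝ) ^ n) / 2) ^ 2) ∧
    Filter.Tendsto
      (fun n : ℕ => Real.log (hanoiTau n : ℝ) / (Fintype.card (HanoiWord n) : ℝ))
      Filter.atTop (nhds ((Real.log 3 + Real.log 5) / 4)) := by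

  refine ⟨fun n _ => ⟨hanoiTau_eq_hanoiComplexity n, fun i => ?_, ?_⟩,
    tendsto_log_hanoiTau_div_card⟩
  · rw [hanoiS_eq, hanoiCount_eq, hanoiComplexity]
    have h : (3 : ℝ) ^ (((3 : ℝ) ^ n + 2 * (n : ℝ) - 1) / 4) =
        (3 : ℝ) ^ (((3 : ℝ) ^ n - 2 * (n : ℝ) - 1) / 4) * 3 ^ n := by
      rw [← Real.rpow_natCast 3 n, ← Real.rpow_add (by norm_num)]
      congr 1
      ring
    simp only [CornerPartition.weight, CornerPartition.degree, h, div_pow]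
    field_simp
    simp
  · rw [hanoiQ_eq, hanoiCount_eq, hanoiComplexity]
    -- The extra 3 is the weight of the three-block partition, and (3^n)² is the denominator of r².
    have h : (3 : ℝ) ^ (((3 : ℝ) ^ n + 2 * (n : ℝ) - 1) / 4) * 3 =
        (3 : ℝ) ^ (((3 : ℝ) ^ n - 6 * (n : ℝ) + 3) / 4) * (3 ^ n) ^ 2 := by
      have h' : ∀ x : ℝ, (3 : ℝ) ^ x * 3 = 3 ^ (x + 1) := fun x => by
        rw [Real.rpow_add (by norm_num), Real.rpow_one]
      rw [← Real.rpow_natCast 3 n, ← Real.rpow_mul_natCast (by norm_num), h',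
        ← Real.rpow_add (by norm_num)]
      congr 1
      push_cast
      ring
    have h' : ((5 / 3 : ℝ) ^ n - 1) / 2 = (5 ^ n - 3 ^ n) / 2 / 3 ^ n := by
      rw [div_pow]
      field_simp
    simp only [CornerPartition.weight, CornerPartition.degree, h']
    rw [div_pow _ ((3 : ℝ) ^ n), Nat.cast_ofNat]
    rw [← eq_div_iff (by norm_num)] at h
    rw [h]
    generalize (5 : ℝ) ^ (((3 : ℝ) ^ n - 2 * (n : ℝ) - 1) / 4) = B
    generalize (3 : ℝ) ^ (((3 : ℝ) ^ n - 6 * (n : ℝ) + 3) / 4) = A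
    field_simp
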